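/- Let $q$ be a prime power and let $\mathbb{F}_q$ be the finite field with $q$ elements. For subspaces $U,W$ of $\mathbb{F}_q^v$ let $d_s(U,W)=\dim(U+W)-\dim(U\cap W)$ be the subspace distance, and let $A_q(v,d;k)$ denote the maximum cardinality of a set of $k$-dimensional subspaces of $\mathbb{F}_q^v$ such that any two distinct members have subspace distance at least $d$. Then $$A_q(9,4;3)\ \ge\ q^{12}+2q^8+2q^7+q^6+2q^5+2q^4-2q^2-2q+1 .$$ -/

import Mathlib

/-- The subspace distance `dim (U + W) - dim (U ∩ W)`; the subtraction never truncates, because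
`U ∩ W ≤ U + W`. -/
noncomputable def subspaceDist {F V : Type*} [Field F] [AddCommGroup V] [Module F V]
    (U W : Submodule F V) : ℕ :=
  Module.finrank F ↥(U ⊔ W) - Module.finrank F ↥(U ⊓ W)

/-- `C` is a constant dimension code: a set of `k`-dimensional subspaces of `F ^ v` with minimum
subspace distance at least `d`. -/
def IsConstDimCode (F : Type*) [Field F] (v d k : ℕ)
    (C : Finset (Submodule F (Fin v → F))) : Prop :=
  (∀ U ∈ C, Module.finrank F U = k) ∧
    ∀ U ∈ C, ∀ W ∈ C, U ≠ W → d ≤ subspaceDist U W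

/-- `A_q(v, d; k)`, where `q` is the number of elements of the finite field `F`: the maximum
cardinality of a set of `k`-dimensional subspaces of `F ^ v` with minimum subspace distance at
least `d`. -/
noncomputable def maxConstDimCode (F : Type*) [Field F] (v d k : ℕ) : ℕ :=
  sSup {n : ℕ | ∃ C : Finset (Submodule F (Fin v → F)), IsConstDimCode F v d k C ∧ C.card = n}

/-- Over a finite field the supremum is an attained maximum. -/
theorem isGreatest_maxConstDimCode (F : Type*) [Field F] [Finite F] (v d k : ℕ) :
    IsGreatest {n : ℕ | ∃ C : Finset (Submodule F (Fin v → F)),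
      IsConstDimCode F v d k C ∧ C.card = n} (maxConstDimCode F v d k) := by
  have hb : BddAbove {n : ℕ | ∃ C : Finset (Submodule F (Fin v → F)),
      IsConstDimCode F v d k C ∧ C.card = n} := by
    refine ⟨Nat.card (Submodule F (Fin v → F)), ?_⟩
    rintro n ⟨C, -, rfl⟩
    have : Finite (Submodule F (Fin v → F)) := inferInstance
    rw [← Nat.card_eq_finsetCard C]
    exact Nat.card_le_card_of_injective _ Subtype.val_injective
  have hn : {n : ℕ | ∃ C : Finset (Submodule F (Fin v → F)),
      IsConstDimCode F v d k C ∧ C.card = n}.Nonempty :=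
    ⟨0, ∅, ⟨by simp, by simp⟩, rfl⟩
  exact ⟨Nat.sSup_mem hn hb, fun n h => le_csSup hb h⟩

/-- The distance condition in terms of intersections: two `k`-spaces have subspace distance at least
`d` if and only if `2 * dim (U ∩ W) + d ≤ 2 * k`. -/
theorem le_subspaceDist_iff {F V : Type*} [Field F] [AddCommGroup V] [Module F V]
    [FiniteDimensional F V] {d k : ℕ} {U W : Submodule F V}
    (hU : Module.finrank F U = k) (hW : Module.finrank F W = k) :
    d ≤ subspaceDist U W ↔ 2 * Module.finrank F ↥(U ⊓ W) + d ≤ 2 * k := by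
  have h := Submodule.finrank_sup_add_finrank_inf_eq U W
  have h' := Submodule.finrank_mono (inf_le_left : U ⊓ W ≤ U)
  unfold subspaceDist
  omega

/-! Subspace distance 4 between planes means meeting in at most a point. Let `K`, `L` be the
extensions of `F` of degrees 3 and 2, and take `(K × K) × K` as the ambient space.

In `K × K`, with the quadratic form Q(x, z) = tr(xz), the graphs of the maps a σ - b σ² pairwise
meet in at most a point. The q³ graphs with a = σ b are the totally singular ones (cross products).
Dropping them makes room for q(q² + q + 1) totally singular planes through a point of `0 × K` and q²
+ q + 1 planes through a line of `0 × K`, giving q⁶ + 2q² + 2q + 1 planes (`pairwise_planeCode`).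

Each of them lifts in q⁶ ways along the same maps. The lines spanned by (0, y) and (s / y, 0) with
tr s = 1 lie in no plane of the code (`not_mem_planeCode`), so planes projecting onto these lines
meet every lifted plane in at most a point. Each line carries q² such planes through (0, 0, s), one
for each z in `L` (`meet_link_link`).

The total, q¹² + 2q⁸ + 2q⁷ + 2q⁶ + q⁵ + q⁴, exceeds the claimed bound. -/

/-! ### Subspaces meeting in at most a point -/

/-- Two subspaces meet in at most a (projective) point. -/
def MeetInPoint {F V : Type*} [Field F] [AddCommGroup V] [Module F V]
    (U W : Submodule F V) : Prop :=
  Module.finrank F ↥(U ⊓ W) ≤ 1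

section Meet

variable {F V V' : Type*} [Field F] [AddCommGroup V] [Module F V] [AddCommGroup V'] [Module F V']

theorem MeetInPoint.symm {U W : Submodule F V} (h : MeetInPoint U W) : MeetInPoint W U := by
  unfold MeetInPoint at *
  rwa [inf_comm]

theorem meetInPoint_of_proj {U W : Submodule F V} (π : V →ₗ[F] V') (w : V')
    (h : ∀ u ∈ U, u ∈ W → ∃ c : F, π u = c • w) (h0 : ∀ u ∈ U, u ∈ W → π u = 0 → u = 0) :
    MeetInPoint U W := by
  have hr : ∀ x : ↥(U ⊓ W), (π ∘ₗ (U ⊓ W).subtype) x ∈ Submodule.span F {w} := by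
    rintro ⟨x, hx⟩
    obtain ⟨c, hc⟩ := h x hx.1 hx.2
    exact Submodule.mem_span_singleton.2 ⟨c, hc.symm⟩
  have hinj : Function.Injective ((π ∘ₗ (U ⊓ W).subtype).codRestrict _ hr) := by
    rw [injective_iff_map_eq_zero]
    rintro ⟨x, hx⟩ hx0
    have : π x = 0 := congrArg Subtype.val hx0
    exact Subtype.ext (h0 x hx.1 hx.2 this)
  refine (LinearMap.finrank_le_finrank_of_injective hinj).trans ?_
  exact (finrank_span_le_card ({w} : Set V')).trans (by simp)

/-- The projection embeds the intersection in a proper subspace of a space of dimension at most 2.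
-/
theorem meetInPoint_of_pair {U W : Submodule F V} (π : V →ₗ[F] V') (p₁ p₂ : V')
    (C : Submodule F V') (h : ∀ u ∈ U, u ∈ W → ∃ a b : F, π u = a • p₁ + b • p₂)
    (hC : ∀ u ∈ U, u ∈ W → π u ∈ C) (hp : p₁ ∈ C → p₂ ∈ C → False)
    (h0 : ∀ u ∈ U, u ∈ W → π u = 0 → u = 0) : MeetInPoint U W := by
  have hlt : C ⊓ Submodule.span F {p₁, p₂} < Submodule.span F {p₁, p₂} := by
    refine lt_of_le_of_ne inf_le_right fun he => ?_
    have hle : Submodule.span F {p₁, p₂} ≤ C := inf_eq_right.1 he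
    exact hp (hle (Submodule.subset_span (by simp))) (hle (Submodule.subset_span (by simp)))
  have hfd : FiniteDimensional F ↥(Submodule.span F {p₁, p₂}) :=
    FiniteDimensional.span_of_finite F (by simp)
  have h2 : Module.finrank F ↥(Submodule.span F {p₁, p₂}) ≤ 2 := by
    classical
    have := finrank_span_finset_le_card (R := F) ({p₁, p₂} : Finset V')
    simp only [Finset.coe_insert, Finset.coe_singleton] at this
    exact this.trans Finset.card_le_two
  have h1 := Submodule.finrank_lt_finrank_of_lt hlt
  have hr : ∀ x : ↥(U ⊓ W), (π ∘ₗ (U ⊓ W).subtype) x ∈ C ⊓ Submodule.span F {p₁, p₂} := by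
    rintro ⟨x, hx⟩
    obtain ⟨a, b, hab⟩ := h x hx.1 hx.2
    exact ⟨hC x hx.1 hx.2, Submodule.mem_span_pair.2 ⟨a, b, hab.symm⟩⟩
  have hinj : Function.Injective ((π ∘ₗ (U ⊓ W).subtype).codRestrict _ hr) := by
    rw [injective_iff_map_eq_zero]
    rintro ⟨x, hx⟩ hx0
    have : π x = 0 := congrArg Subtype.val hx0
    exact Subtype.ext (h0 x hx.1 hx.2 this)
  have hfd' : FiniteDimensional F ↥(C ⊓ Submodule.span F {p₁, p₂}) :=
    Submodule.finiteDimensional_inf_right _ _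
  have := LinearMap.finrank_le_finrank_of_injective hinj
  unfold MeetInPoint
  omega

theorem pairwise_meetInPoint_sumElim {α β : Type*} {P : α → Submodule F V}
    {Q : β → Submodule F V} (hP : Pairwise fun i j => MeetInPoint (P i) (P j))
    (hQ : Pairwise fun i j => MeetInPoint (Q i) (Q j)) (hPQ : ∀ i j, MeetInPoint (P i) (Q j)) :
    Pairwise fun i j => MeetInPoint (Sum.elim P Q i) (Sum.elim P Q j) := by
  rintro (i | i) (j | j) hij
  · exact hP (fun h => hij (h ▸ rfl))
  · exact hPQ i j
  · exact (hPQ j i).symm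
  · exact hQ (fun h => hij (h ▸ rfl))

/-- A finite family of pairwise almost disjoint planes in a nine-dimensional space is a lower bound
for `A_q(9, 4; 3)`. -/
theorem card_le_maxConstDimCode [Finite F] {I : Type*} [Finite I] (P : I → Submodule F V)
    (hV : Module.finrank F V = 9) (h3 : ∀ i, Module.finrank F (P i) = 3)
    (hP : Pairwise fun i j => MeetInPoint (P i) (P j)) :
    Nat.card I ≤ maxConstDimCode F 9 4 3 := by
  classical
  have := Fintype.ofFinite I
  have hfd : FiniteDimensional F V := Module.finite_of_finrank_pos (by omega)
  let e : V ≃ₗ[F] (Fin 9 → F) := LinearEquiv.ofFinrankEq _ _ (by simp [hV])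
  let Q : I → Submodule F (Fin 9 → F) := fun i => (P i).map (e : V →ₗ[F] (Fin 9 → F))
  have hQ3 : ∀ i, Module.finrank F (Q i) = 3 := fun i => by
    rw [← h3 i]; exact LinearEquiv.finrank_map_eq e (P i)
  have hQ : ∀ i j, i ≠ j → Module.finrank F ↥(Q i ⊓ Q j) ≤ 1 := fun i j hij => by
    have hmap : Q i ⊓ Q j = (P i ⊓ P j).map (e : V →ₗ[F] (Fin 9 → F)) :=
      (Submodule.map_inf _ e.injective).symm
    rw [hmap]
    exact (LinearEquiv.finrank_map_eq e (P i ⊓ P j)).trans_le (hP hij)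
  have hinj : Function.Injective Q := fun i j hij => by
    by_contra hne
    have h := hQ i j hne
    rw [hij, inf_idem, hQ3] at h
    omega
  refine (isGreatest_maxConstDimCode F 9 4 3).2 ⟨Finset.univ.image Q, ⟨?_, ?_⟩, ?_⟩
  · intro U hU
    obtain ⟨i, -, rfl⟩ := Finset.mem_image.1 hU
    exact hQ3 i
  · intro U hU W hW hne
    obtain ⟨i, -, rfl⟩ := Finset.mem_image.1 hU
    obtain ⟨j, -, rfl⟩ := Finset.mem_image.1 hW
    have h := hQ i j (fun h => hne (h ▸ rfl))
    rw [le_subspaceDist_iff (hQ3 i) (hQ3 j)]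
    omega
  · rw [Finset.card_image_of_injective _ hinj, Finset.card_univ, Nat.card_eq_fintype_card]

end Meet

/-! ### Cyclic cubic extensions -/

/-- `K` is a cubic extension of `F` in which `σ` generates the Galois group and `tr` is the
trace. -/
structure IsCyclicCubic {F K : Type*} [Field F] [Field K] [Algebra F K]
    (σ : K →ₐ[F] K) (tr : K →ₗ[F] F) : Prop where
  finrank_eq : Module.finrank F K = 3
  cube : ∀ x, σ (σ (σ x)) = x
  fixed : ∀ x, σ x = x → ∃ c : F, algebraMap F K c = x
  trace : ∀ x, algebraMap F K (tr x) = x + σ x + σ (σ x)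
  surj : ∃ τ, tr τ = 1

section Cubic

variable {F K : Type*} [Field F] [Field K] [Algebra F K] {σ : K →ₐ[F] K} {tr : K →ₗ[F] F}

/-- The linear map `x ↦ a σ(x) - b σ²(x)`. -/
def gabidulin (σ : K →ₐ[F] K) (a b : K) : K →ₗ[F] K :=
  LinearMap.mulLeft F a ∘ₗ σ.toLinearMap - LinearMap.mulLeft F b ∘ₗ (σ.comp σ).toLinearMap

@[simp] theorem gabidulin_apply (a b x : K) :
    gabidulin σ a b x = a * σ x - b * σ (σ x) := rfl

/-- The cross product attached to the trace form. -/
def fieldCross (σ : K →ₐ[F] K) (v : K) : K →ₗ[F] K := gabidulin σ (σ (σ v)) (σ v)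

@[simp] theorem fieldCross_apply (v x : K) :
    fieldCross σ v x = σ (σ v) * σ x - σ v * σ (σ x) := rfl

namespace IsCyclicCubic

variable (h : IsCyclicCubic σ tr)
include h

theorem exists_smul_of_mul_eq {x y : K} (hy : y ≠ 0) (hxy : σ x * y = x * σ y) :
    ∃ c : F, x = c • y := by
  have hy' : σ y ≠ 0 := (map_ne_zero σ).2 hy
  obtain ⟨c, hc⟩ := h.fixed (x / y) (by rw [map_div₀]; field_simp; linear_combination hxy)
  exact ⟨c, by rw [Algebra.smul_def, hc]; field_simp⟩

/-- Applying σ² to the vanishing cross product shows that σ fixes x / y. -/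
theorem exists_smul_of_cross_eq_zero {x y : K} (hy : y ≠ 0) (hxy : fieldCross σ x y = 0) :
    ∃ c : F, x = c • y := by
  refine h.exists_smul_of_mul_eq hy ?_
  have h1 := congrArg σ (congrArg σ hxy)
  simp only [fieldCross_apply, map_sub, map_mul, h.cube, map_zero] at h1
  linear_combination h1

theorem trace_mul (x y : K) :
    algebraMap F K (tr (x * y)) = x * y + σ x * σ y + σ (σ x) * σ (σ y) := by
  rw [h.trace]; simp

theorem trace_mul_eq_zero {x y : K} (hxy : tr (x * y) = 0) :
    x * y + σ x * σ y + σ (σ x) * σ (σ y) = 0 := by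
  rw [← h.trace_mul, hxy, map_zero]

/-- A vector orthogonal to two independent vectors is a multiple of their cross product. -/
theorem exists_smul_cross {x y z : K} (hc : fieldCross σ x y ≠ 0)
    (hx : tr (x * z) = 0) (hy : tr (y * z) = 0) : ∃ c : F, z = c • fieldCross σ x y := by
  refine h.exists_smul_of_mul_eq hc ?_
  have h1 := h.trace_mul_eq_zero hx
  have h2 := h.trace_mul_eq_zero hy
  simp only [fieldCross_apply, map_sub, map_mul, h.cube]
  -- This combination eliminates σ² z from the two orthogonality relations.
  linear_combination σ (σ x) * h2 - σ (σ y) * h1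

theorem trace_mul_cross (v x : K) : tr (v * fieldCross σ v x) = 0 := by
  apply (algebraMap F K).injective
  rw [h.trace_mul, map_zero]
  simp only [fieldCross_apply, map_sub, map_mul, h.cube]
  ring

theorem trace_mul_cross' (v x : K) : tr (x * fieldCross σ v x) = 0 := by
  apply (algebraMap F K).injective
  rw [h.trace_mul, map_zero]
  simp only [fieldCross_apply, map_sub, map_mul, h.cube]
  ring

/-- The maps `gabidulin σ a b` form a rank distance code. -/
theorem exists_ker_gabidulin {a b : K} (hab : ¬ (a = 0 ∧ b = 0)) :
    ∃ w, ∀ x, gabidulin σ a b x = 0 → ∃ c : F, x = c • w := by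
  by_cases hw : ∃ w, w ≠ 0 ∧ gabidulin σ a b w = 0
  · obtain ⟨w, hw0, hw⟩ := hw
    refine ⟨w, fun x hx => h.exists_smul_of_cross_eq_zero hw0 ?_⟩
    simp only [gabidulin_apply, fieldCross_apply] at *
    have h1 : σ w ≠ 0 := (map_ne_zero σ).2 hw0
    have h2 : σ (σ w) ≠ 0 := (map_ne_zero σ).2 h1
    have ha : a ≠ 0 := by
      rintro rfl
      have : b = 0 := by simpa [h2] using hw
      exact hab ⟨rfl, this⟩
    have hb : b ≠ 0 := by
      rintro rfl
      exact ha (by simpa [h1] using hw)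
    -- Both kernel equations prescribe the ratio σ / σ² as b / a, so the cross product of x and w
    -- vanishes.
    apply mul_left_cancel₀ (mul_ne_zero ha hb)
    linear_combination b * σ (σ x) * hw - b * σ (σ w) * hx
  · push Not at hw
    refine ⟨0, fun x hx => ⟨0, ?_⟩⟩
    by_contra hne
    exact hw x (by simpa using hne) hx

end IsCyclicCubic

end Cubic

/-! ### Finite fields: Frobenius generates the Galois group of the cubic extension. -/

section Existence

open FiniteField in
theorem isCyclicCubic_of_finrank {F K : Type*} [Field F] [Finite F] [Field K] [Algebra F K]
    (hK : Module.finrank F K = 3) :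
    ∃ σ : K →ₐ[F] K, IsCyclicCubic σ (Algebra.trace F K) := by
  have := Fintype.ofFinite F
  have hfd : FiniteDimensional F K := Module.finite_of_finrank_pos (by omega)
  have hfin : Finite K := Module.finite_of_finite F
  have := Fintype.ofFinite K
  have hcard : Fintype.card K = Fintype.card F ^ 3 := by
    rw [← hK]; exact Module.card_eq_pow_finrank
  have htr : ∀ x, algebraMap F K (Algebra.trace F K x) =
      x + x ^ Fintype.card F + (x ^ Fintype.card F) ^ Fintype.card F := fun x => by
    rw [FiniteField.algebraMap_trace_eq_sum_pow, hK, Nat.card_eq_fintype_card]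
    simp [Finset.sum_range_succ, ← pow_mul, pow_two]
  refine ⟨frobeniusAlgHom F K, hK, fun x => ?_, fun x hx => ?_, htr,
    Algebra.trace_surjective F K 1⟩
  · simp only [coe_frobeniusAlgHom, ← pow_mul]
    rw [← pow_two, ← pow_succ, ← hcard, FiniteField.pow_card]
  · have hgal : IsGalois F K := inferInstance
    refine (IsGalois.mem_range_algebraMap_iff_fixed x).2 fun g => ?_
    obtain ⟨n, rfl⟩ := (bijective_frobeniusAlgEquivOfAlgebraic_pow F K).2 g
    simp only [AlgEquiv.coe_pow]
    refine Function.iterate_fixed ?_ _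
    simpa using hx

theorem exists_field_of_finrank (F : Type*) [Field F] [Finite F] (n : ℕ) [NeZero n] :
    ∃ (K : Type) (_ : Field K) (_ : Algebra F K), Module.finrank F K = n := by
  obtain ⟨p, hp⟩ := CharP.exists F
  have : Fact p.Prime := ⟨CharP.char_is_prime F p⟩
  exact ⟨FiniteField.Extension F p n, inferInstance, inferInstance,
    FiniteField.finrank_extension F p n⟩

end Existence

/-! ### Three kinds of planes in `K × K` and their intersections. -/

section Planes

variable {F K : Type*} [Field F] [Field K] [Algebra F K] {σ : K →ₐ[F] K} {tr : K →ₗ[F] F}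

theorem gabidulin_sub (a b a' b' x : K) :
    gabidulin σ (a - a') (b - b') x = gabidulin σ a b x - gabidulin σ a' b' x := by
  simp only [gabidulin_apply]; ring

namespace IsCyclicCubic

/-- If the map is injective on the orthogonal complement of y, the preimage of the line of y there
is at most a line. Otherwise it kills some x₀ ≠ 0 orthogonal to y, hence is k times the cross
product with x₀. An independent solution x would make y a multiple of x × x₀, forcing k into `F` and
a = σ b. -/
theorem exists_ker_mod (h : IsCyclicCubic σ tr) {a b y : K} (hab : a ≠ σ b) :
    ∃ w, ∀ x, tr (x * y) = 0 → (∃ t : F, gabidulin σ a b x = t • y) → ∃ c : F, x = c • w := by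
  by_cases hex : ∃ x₀, x₀ ≠ 0 ∧ tr (x₀ * y) = 0 ∧ gabidulin σ a b x₀ = 0
  · obtain ⟨x₀, hx₀, hty, hg⟩ := hex
    refine ⟨x₀, fun x hxy ⟨t, ht⟩ => ?_⟩
    by_cases hc : fieldCross σ x x₀ = 0
    · exact h.exists_smul_of_cross_eq_zero hx₀ hc
    · exfalso
      obtain ⟨c, hc'⟩ := h.exists_smul_cross hc hxy hty
      have h1 : σ x₀ ≠ 0 := (map_ne_zero σ).2 hx₀
      have h2 : σ (σ x₀) ≠ 0 := (map_ne_zero σ).2 h1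
      obtain ⟨k, hk⟩ : ∃ k, b = k * σ x₀ := ⟨b / σ x₀, by field_simp⟩
      have hka : a = k * σ (σ x₀) := by
        apply mul_right_cancel₀ h1
        simp only [gabidulin_apply] at hg
        linear_combination hg + σ (σ x₀) * hk
      have hkc : k * fieldCross σ x x₀ = algebraMap F K (-(t * c)) * fieldCross σ x x₀ := by
        rw [hc'] at ht
        simp only [gabidulin_apply, fieldCross_apply, Algebra.smul_def, map_neg, map_mul] at ht ⊢
        rw [hk, hka] at ht
        linear_combination -ht
      have hkF := mul_right_cancel₀ hc hkc
      apply hab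
      rw [hka, hk, map_mul, hkF, AlgHom.commutes]
  · push Not at hex
    by_cases hne : ∃ x₁, x₁ ≠ 0 ∧ tr (x₁ * y) = 0 ∧ ∃ t : F, gabidulin σ a b x₁ = t • y
    · obtain ⟨x₁, hx₁, hty, t₁, ht₁⟩ := hne
      have ht0 : t₁ ≠ 0 := by
        rintro rfl
        exact hex x₁ hx₁ hty (by rw [ht₁, zero_smul])
      refine ⟨x₁, fun x hxy ⟨t, ht⟩ => ⟨t / t₁, ?_⟩⟩
      by_contra hcon
      refine hex (x - (t / t₁) • x₁) (sub_ne_zero.2 hcon) ?_ ?_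
      · rw [sub_mul, smul_mul_assoc, map_sub, map_smul, hxy, hty]; simp
      · rw [map_sub, map_smul, ht, ht₁, smul_smul, div_mul_cancel₀ _ ht0, sub_self]
    · push Not at hne
      refine ⟨0, fun x hxy ⟨t, ht⟩ => ⟨0, ?_⟩⟩
      by_contra hcon
      exact hne x (by simpa using hcon) hxy t ht

end IsCyclicCubic

/-- The lifting of a Gabidulin map to a plane of `K × K`. -/
def graphPlane (σ : K →ₐ[F] K) (a b : K) : K →ₗ[F] K × K :=
  LinearMap.id.prod (gabidulin σ a b)

/-- For `tr τ = 1`, the plane of vectors `(x, λ (τ / y) × x + t y)` with `x` orthogonal to `y`. -/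
def pointPlane (σ : K →ₐ[F] K) (tr : K →ₗ[F] F) (τ y : K) (l : F) : K →ₗ[F] K × K :=
  (LinearMap.mulLeft F y⁻¹ ∘ₗ (LinearMap.id - tr.smulRight τ)).prod
    ((l • fieldCross σ (τ / y)) ∘ₗ LinearMap.mulLeft F y⁻¹ ∘ₗ (LinearMap.id - tr.smulRight τ)
      + tr.smulRight y)

/-- The plane of vectors `(t x, z)` with `tr (x z) = t`. -/
def linePlane (tr : K →ₗ[F] F) (x : K) : K →ₗ[F] K × K :=
  (tr.smulRight x).prod (LinearMap.mulLeft F x⁻¹)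

theorem graphPlane_injective (a b : K) : Function.Injective (graphPlane σ a b) :=
  fun _ _ hxy => congrArg Prod.fst hxy

theorem pointPlane_injective {τ y : K} (hy : y ≠ 0) (l : F) :
    Function.Injective (pointPlane σ tr τ y l) := by
  rw [injective_iff_map_eq_zero]
  intro k hk
  have h1 : y⁻¹ * (k - tr k • τ) = 0 := congrArg Prod.fst hk
  have h2 : l • fieldCross σ (τ / y) (y⁻¹ * (k - tr k • τ)) + tr k • y = 0 :=
    congrArg Prod.snd hk
  rw [h1, map_zero, smul_zero, zero_add, smul_eq_zero, or_iff_left hy] at h2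
  rw [h2, zero_smul, sub_zero] at h1
  simpa [hy] using h1

theorem linePlane_injective {x : K} (hx : x ≠ 0) : Function.Injective (linePlane tr x) := by
  intro k k' hk
  have : x⁻¹ * k = x⁻¹ * k' := congrArg Prod.snd hk
  exact mul_left_cancel₀ (inv_ne_zero hx) this

theorem snd_of_mem_graphPlane {a b : K} {p : K × K}
    (hp : p ∈ LinearMap.range (graphPlane σ a b)) : p.2 = gabidulin σ a b p.1 := by
  obtain ⟨k, rfl⟩ := hp; rfl

theorem fst_of_mem_linePlane {x : K} (hx : x ≠ 0) {p : K × K}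
    (hp : p ∈ LinearMap.range (linePlane tr x)) : p.1 = tr (x * p.2) • x := by
  obtain ⟨k, rfl⟩ := hp
  simp [linePlane, mul_inv_cancel_left₀ hx]

theorem of_mem_pointPlane {τ y : K} (hτ : tr τ = 1) (hy : y ≠ 0) {l : F} {p : K × K}
    (hp : p ∈ LinearMap.range (pointPlane σ tr τ y l)) :
    tr (p.1 * y) = 0 ∧ ∃ t : F, p.2 = l • fieldCross σ (τ / y) p.1 + t • y := by
  obtain ⟨k, rfl⟩ := hp
  refine ⟨?_, tr k, rfl⟩
  have : (pointPlane σ tr τ y l k).1 * y = k - tr k • τ := by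
    change y⁻¹ * (k - tr k • τ) * y = _
    field_simp
  rw [this]
  simp [hτ]

namespace IsCyclicCubic

variable (h : IsCyclicCubic σ tr)
include h

/-- These planes are totally singular for Q. -/
theorem trace_of_mem_pointPlane {τ y : K} (hτ : tr τ = 1) (hy : y ≠ 0) {l : F} {p : K × K}
    (hp : p ∈ LinearMap.range (pointPlane σ tr τ y l)) : tr (p.1 * p.2) = 0 := by
  obtain ⟨h1, t, h2⟩ := of_mem_pointPlane hτ hy hp
  rw [h2, mul_add, mul_smul_comm, mul_smul_comm, map_add, map_smul, map_smul, h1,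
    h.trace_mul_cross']
  simp

theorem meet_graph_graph {a b a' b' : K} (hne : ¬ (a = a' ∧ b = b')) :
    MeetInPoint (LinearMap.range (graphPlane σ a b)) (LinearMap.range (graphPlane σ a' b')) := by
  obtain ⟨w, hw⟩ := h.exists_ker_gabidulin (a := a - a') (b := b - b')
    (by rwa [sub_eq_zero, sub_eq_zero])
  refine meetInPoint_of_proj (LinearMap.fst F K K) w (fun u hu hu' => hw _ ?_)
    fun u hu hu' hu0 => ?_
  · rw [gabidulin_sub, LinearMap.fst_apply, ← snd_of_mem_graphPlane hu,
      ← snd_of_mem_graphPlane hu', sub_self]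
  · have h1 : u.1 = 0 := hu0
    exact Prod.ext h1 (by rw [snd_of_mem_graphPlane hu, h1, map_zero]; rfl)

/-- Subtracting the cross-product part l (τ / y) × x preserves a ≠ σ b and leaves a multiple of y,
so `exists_ker_mod` applies. -/
theorem meet_graph_point {a b : K} (hab : a ≠ σ b) {τ y : K} (hτ : tr τ = 1) (hy : y ≠ 0)
    (l : F) : MeetInPoint (LinearMap.range (graphPlane σ a b))
      (LinearMap.range (pointPlane σ tr τ y l)) := by
  obtain ⟨w, hw⟩ := h.exists_ker_mod (y := y) (a := a - l • σ (σ (τ / y)))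
    (b := b - l • σ (τ / y)) (by simpa [sub_left_inj] using hab)
  refine meetInPoint_of_proj (LinearMap.fst F K K) w (fun u hu hu' => ?_) fun u hu hu' hu0 => ?_
  · obtain ⟨h1, t, h2⟩ := of_mem_pointPlane hτ hy hu'
    refine hw _ h1 ⟨t, ?_⟩
    have h3 := snd_of_mem_graphPlane hu
    rw [h2] at h3
    simp only [gabidulin_apply, fieldCross_apply, LinearMap.fst_apply, Algebra.smul_def] at h3 ⊢
    linear_combination -h3
  · have h1 : u.1 = 0 := hu0
    exact Prod.ext h1 (by rw [snd_of_mem_graphPlane hu, h1, map_zero]; rfl)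

omit h in
theorem meet_graph_line {a b x : K} (hx : x ≠ 0) :
    MeetInPoint (LinearMap.range (graphPlane σ a b)) (LinearMap.range (linePlane tr x)) := by
  refine meetInPoint_of_proj (LinearMap.fst F K K) x (fun u hu hu' => ?_) fun u hu hu' hu0 => ?_
  · exact ⟨_, fst_of_mem_linePlane hx hu'⟩
  · have h1 : u.1 = 0 := hu0
    exact Prod.ext h1 (by rw [snd_of_mem_graphPlane hu, h1, map_zero]; rfl)

/-- The vectors orthogonal to two independent vectors are the multiples of one vector. -/
theorem exists_orthogonal {y y' : K} (hy' : y' ≠ 0) (hne : ¬ ∃ c : F, y = c • y') :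
    ∃ w, ∀ x, tr (x * y) = 0 → tr (x * y') = 0 → ∃ c : F, x = c • w := by
  refine ⟨fieldCross σ y y', fun x hx hx' => h.exists_smul_cross ?_ ?_ ?_⟩
  · exact fun h0 => hne (h.exists_smul_of_cross_eq_zero hy' h0)
  · rwa [mul_comm]
  · rwa [mul_comm]

theorem meet_point_point {τ y y' : K} (hτ : tr τ = 1) (hy : y ≠ 0) (hy' : y' ≠ 0)
    (hne : ¬ ∃ c : F, y = c • y') (l l' : F) :
    MeetInPoint (LinearMap.range (pointPlane σ tr τ y l))
      (LinearMap.range (pointPlane σ tr τ y' l')) := by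
  obtain ⟨w, hw⟩ := h.exists_orthogonal hy' hne
  refine meetInPoint_of_proj (LinearMap.fst F K K) w (fun u hu hu' => ?_) fun u hu hu' hu0 => ?_
  · exact hw _ (of_mem_pointPlane hτ hy hu).1 (of_mem_pointPlane hτ hy' hu').1
  · have h1 : u.1 = 0 := hu0
    obtain ⟨-, t, ht⟩ := of_mem_pointPlane hτ hy hu
    obtain ⟨-, t', ht'⟩ := of_mem_pointPlane hτ hy' hu'
    rw [h1, map_zero, smul_zero, zero_add] at ht ht'
    refine Prod.ext h1 ?_
    rw [ht, Prod.snd_zero]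
    by_cases ht0 : t = 0
    · rw [ht0, zero_smul]
    · refine absurd ⟨t⁻¹ * t', ?_⟩ hne
      rw [mul_smul, ← ht', ht, smul_smul, inv_mul_cancel₀ ht0, one_smul]

theorem meet_point_point_same {τ y : K} (hτ : tr τ = 1) (hy : y ≠ 0) {l l' : F} (hl : l ≠ l') :
    MeetInPoint (LinearMap.range (pointPlane σ tr τ y l))
      (LinearMap.range (pointPlane σ tr τ y l')) := by
  have key : ∀ u ∈ LinearMap.range (pointPlane σ tr τ y l),
      u ∈ LinearMap.range (pointPlane σ tr τ y l') → u.1 = 0 := by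
    intro u hu hu'
    obtain ⟨h1, t, ht⟩ := of_mem_pointPlane hτ hy hu
    obtain ⟨-, t', ht'⟩ := of_mem_pointPlane hτ hy hu'
    have hvy : tr (τ / y * y) = 1 := by rw [div_mul_cancel₀ _ hy, hτ]
    have h2 : (l - l') • fieldCross σ (τ / y) u.1 = (t' - t) • y := by
      rw [ht] at ht'
      rw [sub_smul, sub_smul]
      linear_combination (exp := 1) ht'
    have h3 : t' - t = 0 := by
      -- Pairing with τ / y kills its cross products and takes y to 1.
      have := congrArg (fun z => tr (τ / y * z)) h2
      simp only [mul_smul_comm, map_smul, h.trace_mul_cross, hvy, smul_eq_mul, mul_zero,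
        mul_one] at this
      exact this.symm
    rw [h3, zero_smul, smul_eq_zero, or_iff_right (sub_ne_zero.2 hl)] at h2
    by_contra h0
    obtain ⟨c, hc⟩ := h.exists_smul_of_cross_eq_zero h0 h2
    rw [hc, smul_mul_assoc, map_smul, h1] at hvy
    simp at hvy
  refine meetInPoint_of_proj (LinearMap.snd F K K) y (fun u hu hu' => ?_) fun u hu hu' hu0 => ?_
  · obtain ⟨-, t, ht⟩ := of_mem_pointPlane hτ hy hu
    rw [key u hu hu', map_zero, smul_zero, zero_add] at ht
    exact ⟨t, ht⟩
  · exact Prod.ext (key u hu hu') hu0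

/-- On the line plane Q is the square of the coefficient of x. It vanishes on the totally singular
point plane, so common vectors are multiples of (0, y). -/
theorem meet_point_line {τ y x : K} (hτ : tr τ = 1) (hy : y ≠ 0) (hx : x ≠ 0) (l : F) :
    MeetInPoint (LinearMap.range (pointPlane σ tr τ y l))
      (LinearMap.range (linePlane tr x)) := by
  have key : ∀ u ∈ LinearMap.range (pointPlane σ tr τ y l),
      u ∈ LinearMap.range (linePlane tr x) → u.1 = 0 := by
    intro u hu hu'
    have h1 := h.trace_of_mem_pointPlane hτ hy hu
    have h2 := fst_of_mem_linePlane hx hu'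
    rw [h2, smul_mul_assoc, map_smul, smul_eq_mul, mul_self_eq_zero] at h1
    rw [h2, h1, zero_smul]
  refine meetInPoint_of_proj (LinearMap.snd F K K) y (fun u hu hu' => ?_) fun u hu hu' hu0 => ?_
  · obtain ⟨-, t, ht⟩ := of_mem_pointPlane hτ hy hu
    rw [key u hu hu', map_zero, smul_zero, zero_add] at ht
    exact ⟨t, ht⟩
  · exact Prod.ext (key u hu hu') hu0

/-- Independence of x and x' forces the first coordinate to vanish, and the second is then
orthogonal to both. -/
theorem meet_line_line {x x' : K} (hx : x ≠ 0) (hx' : x' ≠ 0) (hne : ¬ ∃ c : F, x = c • x') :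
    MeetInPoint (LinearMap.range (linePlane tr x)) (LinearMap.range (linePlane tr x')) := by
  obtain ⟨w, hw⟩ := h.exists_orthogonal hx' hne
  have key : ∀ u ∈ LinearMap.range (linePlane tr x), u ∈ LinearMap.range (linePlane tr x') →
      tr (x * u.2) = 0 ∧ tr (x' * u.2) = 0 := by
    intro u hu hu'
    have h1 := fst_of_mem_linePlane hx hu
    have h2 := fst_of_mem_linePlane hx' hu'
    have h3 : tr (x * u.2) = 0 := by
      by_contra h0
      refine hne ⟨(tr (x * u.2))⁻¹ * tr (x' * u.2), ?_⟩
      rw [mul_smul, ← h2, h1, smul_smul, inv_mul_cancel₀ h0, one_smul]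
    rw [h1, h3, zero_smul, eq_comm, smul_eq_zero, or_iff_left hx'] at h2
    exact ⟨h3, h2⟩
  refine meetInPoint_of_proj (LinearMap.snd F K K) w (fun u hu hu' => ?_) fun u hu hu' hu0 => ?_
  · obtain ⟨h1, h2⟩ := key u hu hu'
    exact hw _ (by rwa [mul_comm]) (by rwa [mul_comm])
  · refine Prod.ext ?_ hu0
    rw [fst_of_mem_linePlane hx hu, (key u hu hu').1, zero_smul]; rfl

end IsCyclicCubic

end Planes

open scoped LinearAlgebra.Projectivization

/-! ### The six-dimensional code. -/

section Code

variable {F K : Type*} [Field F] [Field K] [Algebra F K] {σ : K →ₐ[F] K} {tr : K →ₗ[F] F}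

theorem Projectivization.eq_of_rep_eq_smul {y y' : ℙ F K} {c : F} (hc : y.rep = c • y'.rep) :
    y = y' := by
  rw [← y.mk_rep, ← y'.mk_rep, Projectivization.mk_eq_mk_iff']
  exact ⟨c, hc.symm⟩

/-- The index set of a code of planes in `K × K`. -/
abbrev PlaneIndex (σ : K →ₐ[F] K) : Type _ :=
  {p : K × K // p.1 ≠ σ p.2} ⊕ ((ℙ F K × F) ⊕ ℙ F K)

/-- A code of planes in `K × K` that pairwise meet in at most a point. -/
noncomputable def planeCode (σ : K →ₐ[F] K) (tr : K →ₗ[F] F) (τ : K) : PlaneIndex σ → K →ₗ[F] K × K :=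
  Sum.elim (fun p => graphPlane σ p.1.1 p.1.2)
    (Sum.elim (fun p => pointPlane σ tr τ p.1.rep p.2) fun x => linePlane tr x.rep)

theorem planeCode_injective (τ : K) (j : PlaneIndex σ) :
    Function.Injective (planeCode σ tr τ j) := by
  rcases j with p | p | x
  · exact graphPlane_injective _ _
  · exact pointPlane_injective (Projectivization.rep_nonzero _) _
  · exact linePlane_injective (Projectivization.rep_nonzero _)

namespace IsCyclicCubic

variable (h : IsCyclicCubic σ tr)
include h

theorem pairwise_planeCode {τ : K} (hτ : tr τ = 1) : Pairwise fun i j =>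
    MeetInPoint (LinearMap.range (planeCode σ tr τ i)) (LinearMap.range (planeCode σ tr τ j)) := by
  have h0 : ∀ y : ℙ F K, y.rep ≠ 0 := Projectivization.rep_nonzero
  rintro (p | p | x) (p' | p' | x') hij
  · refine h.meet_graph_graph fun hp => hij ?_
    rw [Subtype.ext (Prod.ext hp.1 hp.2)]
  · exact h.meet_graph_point p.2 hτ (h0 _) _
  · exact meet_graph_line (h0 _)
  · exact (h.meet_graph_point p'.2 hτ (h0 _) _).symm
  · obtain ⟨y, l⟩ := p
    obtain ⟨y', l'⟩ := p'
    by_cases hy : y = y'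
    · subst hy
      exact h.meet_point_point_same hτ (h0 _) fun hl =>
        hij (congrArg (fun m => Sum.inr (Sum.inl (y, m))) hl)
    · exact h.meet_point_point hτ (h0 _) (h0 _)
        (fun ⟨c, hc⟩ => hy (Projectivization.eq_of_rep_eq_smul hc)) _ _
  · exact h.meet_point_line hτ (h0 _) (h0 _) _
  · exact (meet_graph_line (h0 _)).symm
  · exact (h.meet_point_line hτ (h0 _) (h0 _) _).symm
  · exact h.meet_line_line (h0 _) (h0 _)
      (fun ⟨c, hc⟩ => hij (by rw [Projectivization.eq_of_rep_eq_smul hc]))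

/-- The line spanned by `(0, y)` and `(s / y, 0)` lies in no plane of the code. -/
theorem not_mem_planeCode {τ s y : K} (hτ : tr τ = 1) (hs : tr s = 1) (hy : y ≠ 0)
    (j : PlaneIndex σ) (h1 : ((0, y) : K × K) ∈ LinearMap.range (planeCode σ tr τ j))
    (h2 : ((s / y, 0) : K × K) ∈ LinearMap.range (planeCode σ tr τ j)) : False := by
  have h0 : ∀ y : ℙ F K, y.rep ≠ 0 := Projectivization.rep_nonzero
  rcases j with p | p | x
  · have := snd_of_mem_graphPlane h1
    rw [map_zero] at this
    exact hy this
  -- The sum (s / y, y) has Q equal to tr s = 1, so it is not singular.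
  · have := h.trace_of_mem_pointPlane hτ (h0 _) (add_mem h1 h2)
    simp [div_mul_cancel₀ _ hy, hs] at this
  · have h1 := fst_of_mem_linePlane (h0 _) h1
    have h2 := fst_of_mem_linePlane (h0 _) h2
    simp only [mul_zero, map_zero, zero_smul, div_eq_zero_iff, hy, or_false] at h2
    rw [h2, map_zero] at hs
    exact zero_ne_one hs

end IsCyclicCubic

/-! ### Lifting to dimension nine. -/

/-- The lifting of a plane of `K × K` to a plane of `(K × K) × K`. -/
def liftPlane (σ : K →ₐ[F] K) (ι : K →ₗ[F] K × K) (a b : K) : K →ₗ[F] (K × K) × K :=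
  ι.prod (gabidulin σ a b)

theorem liftPlane_injective {ι : K →ₗ[F] K × K} (hι : Function.Injective ι) (a b : K) :
    Function.Injective (liftPlane σ ι a b) :=
  fun _ _ hxy => hι (congrArg Prod.fst hxy)

theorem fst_mem_of_mem_liftPlane {ι : K →ₗ[F] K × K} {a b : K} {u : (K × K) × K}
    (hu : u ∈ LinearMap.range (liftPlane σ ι a b)) : u.1 ∈ LinearMap.range ι := by
  obtain ⟨k, rfl⟩ := hu; exact ⟨k, rfl⟩

theorem eq_zero_of_mem_liftPlane {ι : K →ₗ[F] K × K} (hι : Function.Injective ι) {a b : K}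
    {u : (K × K) × K} (hu : u ∈ LinearMap.range (liftPlane σ ι a b)) (hu0 : u.1 = 0) : u = 0 := by
  obtain ⟨k, rfl⟩ := hu
  have : ι k = 0 := hu0
  rw [(map_eq_zero_iff ι hι).1 this, map_zero]

theorem meet_liftPlane_of_meet [FiniteDimensional F K] {ι ι' : K →ₗ[F] K × K} (hι : Function.Injective ι)
    (hm : MeetInPoint (LinearMap.range ι) (LinearMap.range ι')) (a b a' b' : K) :
    MeetInPoint (LinearMap.range (liftPlane σ ι a b))
      (LinearMap.range (liftPlane σ ι' a' b')) := by
  obtain ⟨v, hv⟩ := finrank_le_one_iff.1 hm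
  refine meetInPoint_of_proj (LinearMap.fst F _ _) v.1 (fun u hu hu' => ?_)
    fun u hu hu' hu0 => eq_zero_of_mem_liftPlane hι hu hu0
  obtain ⟨c, hc⟩ := hv ⟨u.1, fst_mem_of_mem_liftPlane hu, fst_mem_of_mem_liftPlane hu'⟩
  exact ⟨c, (congrArg Subtype.val hc).symm⟩

theorem IsCyclicCubic.meet_liftPlane_same (h : IsCyclicCubic σ tr) {ι : K →ₗ[F] K × K}
    (hι : Function.Injective ι) {a b a' b' : K} (hne : ¬ (a = a' ∧ b = b')) :
    MeetInPoint (LinearMap.range (liftPlane σ ι a b))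
      (LinearMap.range (liftPlane σ ι a' b')) := by
  obtain ⟨w, hw⟩ := h.exists_ker_gabidulin (a := a - a') (b := b - b')
    (by rwa [sub_eq_zero, sub_eq_zero])
  refine meetInPoint_of_proj (LinearMap.fst F _ _) (ι w) (fun u hu hu' => ?_)
    fun u hu hu' hu0 => eq_zero_of_mem_liftPlane hι hu hu0
  obtain ⟨k, rfl⟩ := hu
  obtain ⟨k', hk'⟩ := hu'
  have h1 : k' = k := hι (congrArg Prod.fst hk')
  have h2 : gabidulin σ a' b' k' = gabidulin σ a b k := congrArg Prod.snd hk'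
  obtain ⟨c, hc⟩ := hw k (by rw [gabidulin_sub, ← h2, h1, sub_self])
  exact ⟨c, by rw [← map_smul, ← hc]; rfl⟩

/-! ### Link planes: multiplication in `L` supplies q² maps from the base line to the kernel of the
trace, any two agreeing only at 0. -/

variable {L : Type*} [Field L] [Algebra F L]

/-- A plane through the point `(0, 0, s)` over the line spanned by `(0, y)` and `(s / y, 0)`. -/
def linkPlane (ε : L ≃ₗ[F] F × F) (κ : L ≃ₗ[F] LinearMap.ker tr) (s y : K) (z : L) :
    L × F →ₗ[F] (K × K) × K :=
  ((((LinearMap.fst F F F ∘ₗ ε.toLinearMap).smulRight (s / y)).prod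
    ((LinearMap.snd F F F ∘ₗ ε.toLinearMap).smulRight y)) ∘ₗ LinearMap.fst F L F).prod
  ((LinearMap.ker tr).subtype ∘ₗ κ.toLinearMap ∘ₗ LinearMap.mulLeft F z ∘ₗ LinearMap.fst F L F +
    (LinearMap.snd F L F).smulRight s)

variable {ε : L ≃ₗ[F] F × F} {κ : L ≃ₗ[F] LinearMap.ker tr}

theorem linkPlane_apply (s y : K) (z w : L) (t : F) :
    linkPlane ε κ s y z (w, t) =
      (((ε w).1 • (s / y), (ε w).2 • y), (κ (z * w) : K) + t • s) := rfl

theorem eq_zero_of_linkPlane_fst {s y : K} (hs : s ≠ 0) (hy : y ≠ 0) {z w : L} {t : F}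
    (h0 : (linkPlane ε κ s y z (w, t)).1 = 0) : w = 0 := by
  have h1 : (ε w).1 • (s / y) = 0 := congrArg Prod.fst h0
  have h2 : (ε w).2 • y = 0 := congrArg Prod.snd h0
  rw [smul_eq_zero, or_iff_left (div_ne_zero hs hy)] at h1
  rw [smul_eq_zero, or_iff_left hy] at h2
  exact (map_eq_zero_iff ε ε.injective).1 (Prod.ext h1 h2)

theorem linkPlane_injective {s y : K} (hs : s ≠ 0) (hy : y ≠ 0) (z : L) :
    Function.Injective (linkPlane ε κ s y z) := by
  rw [injective_iff_map_eq_zero]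
  rintro ⟨w, t⟩ h0
  have hw : w = 0 := eq_zero_of_linkPlane_fst hs hy (congrArg Prod.fst h0)
  subst hw
  have h2 : ((κ (z * 0) : K)) + t • s = 0 := congrArg Prod.snd h0
  simpa [hs] using h2

theorem ne_zero_of_trace_eq_one {s : K} (hs : tr s = 1) : s ≠ 0 := by
  rintro rfl
  simp at hs

/-- Lifted planes project injectively to `K × K`, and the base line of a link plane is not contained
in a code plane. -/
theorem IsCyclicCubic.meet_lift_link (h : IsCyclicCubic σ tr) {τ s y : K} (hτ : tr τ = 1)
    (hs : tr s = 1) (hy : y ≠ 0) (j : PlaneIndex σ) (a b : K) (z : L) :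
    MeetInPoint (LinearMap.range (liftPlane σ (planeCode σ tr τ j) a b))
      (LinearMap.range (linkPlane ε κ s y z)) := by
  refine meetInPoint_of_pair (LinearMap.fst F _ _) (0, y) (s / y, 0)
    (LinearMap.range (planeCode σ tr τ j)) (fun u _ hu' => ?_)
    (fun u hu _ => fst_mem_of_mem_liftPlane hu) (h.not_mem_planeCode hτ hs hy j)
    fun u hu _ hu0 => eq_zero_of_mem_liftPlane (planeCode_injective τ j) hu hu0
  obtain ⟨⟨w, t⟩, rfl⟩ := hu'
  exact ⟨(ε w).2, (ε w).1, by simp [linkPlane_apply]⟩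

/-- Link planes over different lines or through different points. -/
theorem meet_link_link {s y s' y' : K} (hs : tr s = 1) (hs' : tr s' = 1) (hy : y ≠ 0)
    (hy' : y' ≠ 0) {z z' : L} (hyy : y = y' ∨ ¬ ∃ c : F, y = c • y')
    (hne : ¬ (s = s' ∧ y = y' ∧ z = z')) :
    MeetInPoint (LinearMap.range (linkPlane ε κ s y z))
      (LinearMap.range (linkPlane ε κ s' y' z')) := by
  have hs0 := ne_zero_of_trace_eq_one hs
  have hs0' := ne_zero_of_trace_eq_one hs'
  -- Normalising tr s = tr s' = 1 makes distinct s and s' linearly independent.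
  have hss : ∀ c c' : F, c • s = c' • s' → c = c' := fun c c' hc => by
    simpa [hs, hs'] using congrArg tr hc
  -- the intersection consists of multiples of `s` when it lies over the origin
  have hcenter : s = s' → (∀ w t w' t', linkPlane ε κ s y z (w, t) =
      linkPlane ε κ s' y' z' (w', t') → w = 0) →
      MeetInPoint (LinearMap.range (linkPlane ε κ s y z))
        (LinearMap.range (linkPlane ε κ s' y' z')) := by
    rintro - hw
    refine meetInPoint_of_proj LinearMap.id ((0, s) : (K × K) × K) ?_ (fun u _ _ hu0 => hu0)
    rintro _ ⟨⟨w, t⟩, rfl⟩ ⟨⟨w', t'⟩, hu⟩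
    have := hw w t w' t' hu.symm
    subst this
    exact ⟨t, by simp [linkPlane_apply]⟩
  -- for distinct `s`, `s'` the projection along the third coordinate is injective
  have hproj : s ≠ s' → ∀ u ∈ LinearMap.range (linkPlane ε κ s y z),
      u ∈ LinearMap.range (linkPlane ε κ s' y' z') → u.1 = 0 → u = 0 := by
    rintro hne _ ⟨⟨w, t⟩, rfl⟩ ⟨⟨w', t'⟩, hu⟩ hu0
    have hw := eq_zero_of_linkPlane_fst hs0 hy hu0
    have hw' := eq_zero_of_linkPlane_fst hs0' hy' ((congrArg Prod.fst hu).trans hu0)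
    subst hw hw'
    have h2 : t' • s' = t • s := by simpa [linkPlane_apply] using congrArg Prod.snd hu
    have h3 := hss _ _ h2.symm
    by_cases ht : t = 0
    · rw [ht]; simp [linkPlane_apply]
    · rw [← h3] at h2
      exact absurd (smul_right_injective K ht h2).symm hne
  rcases hyy with rfl | hyy
  · have hcomp : ∀ w t w' t', linkPlane ε κ s y z (w, t) = linkPlane ε κ s' y z' (w', t') →
        (ε w).1 • s = (ε w').1 • s' ∧ (ε w).2 = (ε w').2 := by
      intro w t w' t' hu
      have h1 : (ε w).1 • (s / y) = (ε w').1 • (s' / y) := congrArg (fun u => u.1.1) hu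
      have h2 : (ε w).2 • y = (ε w').2 • y := congrArg (fun u => u.1.2) hu
      refine ⟨?_, smul_left_injective F hy h2⟩
      have := congrArg (· * y) h1
      simpa [smul_mul_assoc, div_mul_cancel₀ _ hy] using this
    by_cases hs1 : s = s'
    · have hz : z ≠ z' := fun hz => hne ⟨hs1, rfl, hz⟩
      refine hcenter hs1 fun w t w' t' hu => ?_
      obtain ⟨h1, h2⟩ := hcomp w t w' t' hu
      have hw : w = w' := ε.injective (Prod.ext (hss _ _ h1) h2)
      subst hs1 hw
      have h3 : (κ (z * w) : K) + t • s = (κ (z' * w) : K) + t' • s := congrArg Prod.snd hu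
      -- The trace kills the values of κ and reads off the coefficient of s.
      have h4 : t = t' := by
        have := congrArg tr h3
        simpa [LinearMap.mem_ker.1 (κ (z * w)).2, LinearMap.mem_ker.1 (κ (z' * w)).2, hs]
          using this
      rw [h4, add_left_inj] at h3
      have h5 := κ.injective (Subtype.ext h3)
      by_contra hw0
      exact hz (mul_right_cancel₀ hw0 h5)
    -- The base lines for s ≠ s' and the same y share only the multiples of (0, y).
    · refine meetInPoint_of_proj (LinearMap.fst F _ _) (0, y) ?_ (hproj hs1)
      rintro _ ⟨⟨w, t⟩, rfl⟩ ⟨⟨w', t'⟩, hu⟩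
      have h1 := (hcomp w t w' t' hu.symm).1
      have h2 := hss _ _ h1
      have h3 : (ε w).1 = 0 := by
        by_contra h0
        rw [← h2] at h1
        exact hs1 (smul_right_injective K h0 h1)
      exact ⟨(ε w).2, by simp [linkPlane_apply, h3]⟩
  · have hcomp : ∀ w t w' t', linkPlane ε κ s y z (w, t) = linkPlane ε κ s' y' z' (w', t') →
        (ε w).2 = 0 := by
      intro w t w' t' hu
      have h2 : (ε w).2 • y = (ε w').2 • y' := congrArg (fun u => u.1.2) hu
      by_contra h0
      exact hyy ⟨((ε w).2)⁻¹ * (ε w').2, by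
        rw [mul_smul, ← h2, smul_smul, inv_mul_cancel₀ h0, one_smul]⟩
    by_cases hs1 : s = s'
    -- For the same s and independent y, y' the base lines are disjoint, so only the centre (0, 0,
    -- s) is shared.
    · refine hcenter hs1 fun w t w' t' hu => ?_
      have h2 := hcomp w t w' t' hu
      have h1 : (ε w).1 • (s / y) = (ε w').1 • (s' / y') := congrArg (fun u => u.1.1) hu
      subst hs1
      have h3 : (ε w).1 • y' = (ε w').1 • y := by
        simp only [Algebra.smul_def] at h1 ⊢
        field_simp at h1
        linear_combination h1
      have h4 : (ε w').1 = 0 := by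
        by_contra h0
        exact hyy ⟨((ε w').1)⁻¹ * (ε w).1, by
          rw [mul_smul, h3, smul_smul, inv_mul_cancel₀ h0, one_smul]⟩
      rw [h4, zero_smul, smul_eq_zero, or_iff_left hy'] at h3
      exact (map_eq_zero_iff ε ε.injective).1 (Prod.ext h3 h2)
    -- Independence of y and y' leaves only multiples of (s / y, 0) as common base vectors.
    · refine meetInPoint_of_proj (LinearMap.fst F _ _) (s / y, 0) ?_ (hproj hs1)
      rintro _ ⟨⟨w, t⟩, rfl⟩ ⟨⟨w', t'⟩, hu⟩
      have h2 := hcomp w t w' t' hu.symm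
      exact ⟨(ε w).1, by simp [linkPlane_apply, h2]⟩

/-- The planes of `(K × K) × K` in the lifted code together with the link planes. -/
noncomputable def linkedCode (σ : K →ₐ[F] K) (tr : K →ₗ[F] F) (τ : K) (ε : L ≃ₗ[F] F × F)
    (κ : L ≃ₗ[F] LinearMap.ker tr) :
    (PlaneIndex σ × K × K) ⊕ ({s : K // tr s = 1} × ℙ F K × L) → Submodule F ((K × K) × K) :=
  Sum.elim (fun i => LinearMap.range (liftPlane σ (planeCode σ tr τ i.1) i.2.1 i.2.2))
    fun i => LinearMap.range (linkPlane ε κ i.1.1 i.2.1.rep i.2.2)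

namespace IsCyclicCubic

variable (h : IsCyclicCubic σ tr)
include h

theorem pairwise_linkedCode {τ : K} (hτ : tr τ = 1) : Pairwise fun i j =>
    MeetInPoint (linkedCode σ tr τ ε κ i) (linkedCode σ tr τ ε κ j) := by
  have : FiniteDimensional F K := Module.finite_of_finrank_pos (by rw [h.finrank_eq]; omega)
  refine pairwise_meetInPoint_sumElim ?_ ?_ ?_
  · rintro ⟨j, a, b⟩ ⟨j', a', b'⟩ hne
    by_cases hj : j = j'
    · subst hj
      refine h.meet_liftPlane_same (planeCode_injective τ j) fun hab => hne ?_
      exact Prod.ext rfl (Prod.ext hab.1 hab.2)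
    · exact meet_liftPlane_of_meet (planeCode_injective τ j) (h.pairwise_planeCode hτ hj) _ _ _ _
  · rintro ⟨⟨s, hs⟩, y, z⟩ ⟨⟨s', hs'⟩, y', z'⟩ hne
    refine meet_link_link hs hs' y.rep_nonzero y'.rep_nonzero ?_ ?_
    · by_cases hy : y = y'
      · exact Or.inl (by rw [hy])
      · exact Or.inr fun ⟨c, hc⟩ => hy (Projectivization.eq_of_rep_eq_smul hc)
    · rintro ⟨h1, h2, h3⟩
      have hy : y = y' := Projectivization.eq_of_rep_eq_smul (c := 1) (by rw [one_smul]; exact h2)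
      subst h1 hy h3
      exact hne rfl
  · rintro ⟨j, a, b⟩ ⟨⟨s, hs⟩, y, z⟩
    exact h.meet_lift_link hτ hs y.rep_nonzero j a b z

theorem finrank_linkedCode (hL : Module.finrank F L = 2) {τ : K}
    (i : (PlaneIndex σ × K × K) ⊕ ({s : K // tr s = 1} × ℙ F K × L)) :
    Module.finrank F (linkedCode σ tr τ ε κ i) = 3 := by
  have : FiniteDimensional F L := Module.finite_of_finrank_pos (by omega)
  rcases i with ⟨j, a, b⟩ | ⟨⟨s, hs⟩, y, z⟩
  · exact (LinearMap.finrank_range_of_inj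
      (liftPlane_injective (planeCode_injective τ j) a b)).trans h.finrank_eq
  · refine (LinearMap.finrank_range_of_inj (linkPlane_injective
      (ne_zero_of_trace_eq_one hs) y.rep_nonzero z)).trans ?_
    rw [Module.finrank_prod, hL, Module.finrank_self]

/-! ### Counting. -/

theorem finrank_ker_trace : Module.finrank F (LinearMap.ker tr) = 2 := by
  have : FiniteDimensional F K := Module.finite_of_finrank_pos (by rw [h.finrank_eq]; omega)
  have h1 := LinearMap.finrank_range_add_finrank_ker tr
  obtain ⟨τ, hτ⟩ := h.surj
  have h2 : LinearMap.range tr = ⊤ := LinearMap.range_eq_top.2 fun c =>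
    ⟨c • τ, by rw [map_smul, hτ, smul_eq_mul, mul_one]⟩
  rw [h2, finrank_top, Module.finrank_self, h.finrank_eq] at h1
  omega

theorem natCard_trace_eq_one : Nat.card {s : K // tr s = 1} = Nat.card F ^ 2 := by
  obtain ⟨τ, hτ⟩ := h.surj
  have : FiniteDimensional F K := Module.finite_of_finrank_pos (by rw [h.finrank_eq]; omega)
  rw [← h.finrank_ker_trace, ← Module.natCard_eq_pow_finrank]
  refine Nat.card_congr ((Equiv.subRight τ).subtypeEquiv fun s => ?_)
  rw [LinearMap.mem_ker, Equiv.subRight_apply, map_sub, hτ, sub_eq_zero]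

theorem natCard_eq : Nat.card K = Nat.card F ^ 3 := by
  have : FiniteDimensional F K := Module.finite_of_finrank_pos (by rw [h.finrank_eq]; omega)
  rw [← h.finrank_eq, ← Module.natCard_eq_pow_finrank]

theorem natCard_projectivization [Finite F] : Nat.card (ℙ F K) = Nat.card F ^ 2 + Nat.card F + 1 := by
  rw [Projectivization.card_of_finrank F K h.finrank_eq]
  simp [Finset.sum_range_succ]
  ring

/-- The q³ discarded graphs are outnumbered by the (q + 1)(q² + q + 1) planes of the other two
kinds. -/
theorem natCard_planeIndex [Finite F] :
    (Nat.card (PlaneIndex σ) : ℤ) =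
      (Nat.card F : ℤ) ^ 6 + 2 * (Nat.card F : ℤ) ^ 2 + 2 * (Nat.card F : ℤ) + 1 := by
  have : FiniteDimensional F K := Module.finite_of_finrank_pos (by rw [h.finrank_eq]; omega)
  have : Finite K := Module.finite_of_finite F
  have h1 : Nat.card {p : K × K // p.1 = σ p.2} = Nat.card F ^ 3 := by
    rw [← h.natCard_eq]
    exact Nat.card_congr ⟨fun p => p.1.2, fun b => ⟨(σ b, b), rfl⟩,
      fun p => Subtype.ext (Prod.ext p.2.symm rfl), fun _ => rfl⟩
  have h2 : Nat.card {p : K × K // p.1 = σ p.2} + Nat.card {p : K × K // p.1 ≠ σ p.2} =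
      Nat.card F ^ 6 := by
    classical
    rw [← Nat.card_sum, Nat.card_congr (Equiv.sumCompl _), Nat.card_prod, h.natCard_eq]
    ring
  rw [Nat.card_sum, Nat.card_sum, Nat.card_prod, h.natCard_projectivization]
  rw [h1] at h2
  zify at h2
  push_cast
  linear_combination h2

end IsCyclicCubic

end Code

theorem mainTheorem2 (F : Type*) [Field F] [Finite F] (q : ℕ) (hq : Nat.card F = q) :
    (maxConstDimCode F 9 4 3 : ℤ) ≥
      (q : ℤ) ^ 12 + 2 * (q : ℤ) ^ 8 + 2 * (q : ℤ) ^ 7 + (q : ℤ) ^ 6 + 2 * (q : ℤ) ^ 5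
        + 2 * (q : ℤ) ^ 4 - 2 * (q : ℤ) ^ 2 - 2 * (q : ℤ) + 1 := by
  subst hq
  obtain ⟨K, _, _, hK⟩ := exists_field_of_finrank F 3
  obtain ⟨L, _, _, hL⟩ := exists_field_of_finrank F 2
  have : FiniteDimensional F K := Module.finite_of_finrank_pos (by omega)
  have : FiniteDimensional F L := Module.finite_of_finrank_pos (by omega)
  have : Finite K := Module.finite_of_finite F
  have : Finite L := Module.finite_of_finite F
  obtain ⟨σ, h⟩ := isCyclicCubic_of_finrank hK
  obtain ⟨τ, hτ⟩ := h.surj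
  let ε : L ≃ₗ[F] F × F := LinearEquiv.ofFinrankEq _ _ (by simp [hL])
  let κ : L ≃ₗ[F] LinearMap.ker (Algebra.trace F K) :=
    LinearEquiv.ofFinrankEq _ _ (by rw [hL, h.finrank_ker_trace])
  have hcard := card_le_maxConstDimCode (linkedCode σ _ τ ε κ) (by simp [hK])
    (h.finrank_linkedCode hL) (h.pairwise_linkedCode hτ)
  rw [Nat.card_sum, Nat.card_prod, Nat.card_prod, Nat.card_prod, Nat.card_prod,
    h.natCard_trace_eq_one, h.natCard_projectivization, h.natCard_eq,
    Module.natCard_eq_pow_finrank (K := F) (V := L), hL] at hcard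
  zify at hcard
  rw [h.natCard_planeIndex] at hcard
  have hq : (2 : ℤ) ≤ Nat.card F := by exact_mod_cast Finite.one_lt_card (α := F)
  generalize (Nat.card F : ℤ) = q at hcard hq
  refine le_trans ?_ hcard
  -- The code exceeds the bound by q⁶ - q⁵ - q⁴ + 2q² + 2q - 1, which is the sum of the expressions
  -- in `h1` and `h2` plus 3.
  have h1 : 0 ≤ q ^ 4 * (q * (q - 2) + (q - 1)) := by
    have : 0 ≤ q - 2 := by linarith
    have : 0 ≤ q - 1 := by linarith
    positivity
  have h2 : 0 ≤ 2 * q ^ 2 + 2 * (q - 2) := by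
    have : 0 ≤ q - 2 := by linarith
    positivity
  linear_combination h1 + h2
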